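/- Let $n\ge 1$ be an integer. Let $\mathrm{sleaf}_n$, $\mathrm{cleaf}_n$ be the solutions of $r''(l)=-n\,r(l)^{2n-1}$, and $\mathrm{sleafh}_n$, $\mathrm{cleafh}_n$ the solutions of $r''(l)=n\,r(l)^{2n-1}$, with the initial values $r(0)=0,\ r'(0)=1$ for $\mathrm{sleaf}_n,\mathrm{sleafh}_n$ and $r(0)=1,\ r'(0)=0$ for $\mathrm{cleaf}_n,\mathrm{cleafh}_n$. For complex arguments each of these functions is understood as the continuation of the holomorphic solution near $0$ along straight rays from $0$: a point $z$ is in the domain $D(f)$ of such a function $f$ if the solution near $0$ extends to a meromorphic function on an open set containing $z$ that is star-shaped about $0$, with no pole at $z$; then $f(z)$ is the value of this extension. Put $$\zeta_n=\int_0^\infty\frac{dt}{\sqrt{1+t^{2n}}},\qquad \eta_n=\int_1^\infty\frac{dt}{\sqrt{t^{2n}-1}}$$ (both are $\infty$ for $n=1$). Then: 1. $\mathbb R\subset D(\mathrm{sleaf}_n)$, $\mathbb R\subset D(\mathrm{cleaf}_n)$, $(-\zeta_n,\zeta_n)\subset D(\mathrm{sleafh}_n)$ and $(-\eta_n,\eta_n)\subset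 D(\mathrm{cleafh}_n)$. 2. If $n$ is odd, then $l\in D(\mathrm{sleaf}_n)$ if and only if $i l\in D(\mathrm{sleafh}_n)$, and for all such $l$ $$\mathrm{sleaf}_n(l)=-i\,\mathrm{sleafh}_n(i l).$$ 3. If $n$ is even (in particular if $n=2$), then $l\in D(\mathrm{sleaf}_n)$ if and only if $i l\in D(\mathrm{sleaf}_n)$, $l\in D(\mathrm{sleafh}_n)$ if and only if $i l\in D(\mathrm{sleafh}_n)$, and for all $l$ in the respective domain $$\mathrm{sleaf}_n(i l)=i\,\mathrm{sleaf}_n(l),\qquad \mathrm{sleafh}_n(i l)=i\,\mathrm{sleafh}_n(l).$$ 4. For every $n$: $l\in D(\mathrm{cleaf}_n)$ if and only if $i l\in D(\mathrm{cleafh}_n)$, and then $\mathrm{cleaf}_n(l)=\mathrm{cleafh}_n(i l)$; likewise $l\in D(\mathrm{cleafh}_n)$ if and only if $i l\in D(\mathrm{cleaf}_n)$, and then $\mathrm{cleaf}_n(i l)=\mathrm{cleafh}_n(l)$. -/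

import Mathlib

open Complex Filter Topology MeasureTheory

/-- `f` continues, along straight rays from the origin, the solution of the initial value problem
`r'' = κ * r ^ (2 n - 1)`, `r 0 = a`, `r' 0 = b`: the function `f` is meromorphic on the open set
`U`, which is star-shaped about `0`, is holomorphic at `0`, and solves the problem near `0`. -/
structure IsLeafContinuation (κ : ℂ) (n : ℕ) (a b : ℂ) (U : Set ℂ) (f : ℂ → ℂ) : Prop where
  isOpen : IsOpen U
  zero_mem : (0 : ℂ) ∈ U
  starConvex : StarConvex ℝ (0 : ℂ) U
  meromorphicOn : MeromorphicOn f U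
  analyticAt_zero : AnalyticAt ℂ f 0
  ode : ∀ᶠ z in 𝓝 (0 : ℂ), deriv (deriv f) z = κ * f z ^ (2 * n - 1)
  value_zero : f 0 = a
  deriv_zero : deriv f 0 = b

/-- The points that can be reached by such a continuation and are not poles of it. -/
def leafDomain (κ : ℂ) (n : ℕ) (a b : ℂ) : Set ℂ :=
  {z | ∃ p : Set ℂ × (ℂ → ℂ), IsLeafContinuation κ n a b p.1 p.2 ∧ z ∈ p.1 ∧ AnalyticAt ℂ p.2 z}

open Classical in
/-- The value of the continued solution at a point of `leafDomain` (by the identity theorem it does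
not depend on the continuation that is chosen), and `0` elsewhere. -/
noncomputable def leafValue (κ : ℂ) (n : ℕ) (a b : ℂ) (z : ℂ) : ℂ :=
  if h : z ∈ leafDomain κ n a b then h.choose.2 z else 0

/-- The domain of the leaf function `sleaf n`. -/
def sleafDomain (n : ℕ) : Set ℂ := leafDomain (-(n : ℂ)) n 0 1

/-- The leaf function `sleaf n`: `r'' = -n r ^ (2 n - 1)`, `r 0 = 0`, `r' 0 = 1`. -/
noncomputable def sleaf (n : ℕ) (l : ℂ) : ℂ := leafValue (-(n : ℂ)) n 0 1 l

/-- The domain of the leaf function `cleaf n`. -/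
def cleafDomain (n : ℕ) : Set ℂ := leafDomain (-(n : ℂ)) n 1 0

/-- The leaf function `cleaf n`: `r'' = -n r ^ (2 n - 1)`, `r 0 = 1`, `r' 0 = 0`. -/
noncomputable def cleaf (n : ℕ) (l : ℂ) : ℂ := leafValue (-(n : ℂ)) n 1 0 l

/-- The domain of the hyperbolic leaf function `sleafh n`. -/
def sleafhDomain (n : ℕ) : Set ℂ := leafDomain (n : ℂ) n 0 1

/-- The hyperbolic leaf function `sleafh n`: `r'' = n r ^ (2 n - 1)`, `r 0 = 0`, `r' 0 = 1`. -/
noncomputable def sleafh (n : ℕ) (l : ℂ) : ℂ := leafValue (n : ℂ) n 0 1 l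

/-- The domain of the hyperbolic leaf function `cleafh n`. -/
def cleafhDomain (n : ℕ) : Set ℂ := leafDomain (n : ℂ) n 1 0

/-- The hyperbolic leaf function `cleafh n`: `r'' = n r ^ (2 n - 1)`, `r 0 = 1`, `r' 0 = 0`. -/
noncomputable def cleafh (n : ℕ) (l : ℂ) : ℂ := leafValue (n : ℂ) n 1 0 l

/-- The limit `ζ n = ∫_0^∞ dt / √(1 + t ^ (2 n))` of `sleafh n`; it is `∞` for `n = 1`. -/
noncomputable def leafZeta (n : ℕ) : ENNReal :=
  ∫⁻ t in Set.Ioi (0 : ℝ), ENNReal.ofReal (1 / Real.sqrt (1 + t ^ (2 * n)))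

/-- The limit `η n = ∫_1^∞ dt / √(t ^ (2 n) - 1)` of `cleafh n`; it is `∞` for `n = 1`. -/
noncomputable def leafEta (n : ℕ) : ENNReal :=
  ∫⁻ t in Set.Ioi (1 : ℝ), ENNReal.ofReal (1 / Real.sqrt (t ^ (2 * n) - 1))

/-! The functional equations are symmetries of the equation: if `r` solves it with constant `κ`,
then `c * r (d * z)` solves it with `κ'` whenever `κ' * c ^ (2 * n - 1) = c * d ^ 2 * κ`. Take `d =
I`, with `c = -I` or `c = 1` so that the initial values survive; for `c = -I` the parity of `n`
decides whether `κ` changes sign. Preimages of star-shaped sets under `z ↦ d * z` are star-shaped,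
so domains correspond as well (`mem_leafDomain_iff_mul_mem`, `leafValue_mul`). Values are well
defined by `IsLeafContinuation.eq`.

The real domains need existence. Picard's radius is uniform while a solution stays bounded, so an a
priori bound on `[0, T]` yields a holomorphic solution on a rectangle around the segment, a convex
set containing `T` (`mem_leafDomain_of_bound`). Bounds come from the energy `n * r' ^ 2 - κ * r ^ (2
* n)`: for `κ = -n` both terms are nonnegative; for `κ = n`, climbing to height `X` takes at least
the time given by the truncated integral for `ζ` or `η`, which exceeds `T` for suitable `X`. -/

/-! ### Existence and uniqueness for holomorphic differential equations -/

/-- **Picard's theorem for holomorphic ordinary differential equations**, on a disc whose radius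
depends only on bounds for the vector field. -/
theorem exists_holomorphic_solution_ball {E : Type*} [NormedAddCommGroup E] [NormedSpace ℂ E]
    [CompleteSpace E] {v : E → E} (hv : Differentiable ℂ v) {y₀ : E} {K : NNReal} {C ρ : ℝ}
    (hK : LipschitzOnWith K v (Metric.closedBall y₀ 1))
    (hC : ∀ y ∈ Metric.closedBall y₀ 1, ‖v y‖ ≤ C) (hρ : 0 < ρ) (hCρ : C * ρ ≤ 1)
    (hKρ : K * ρ ≤ 1 / 2) (z₀ : ℂ) :
    ∃ y : ℂ → E, y z₀ = y₀ ∧ ∀ z ∈ Metric.ball z₀ ρ, HasDerivAt y (v (y z)) z := by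
  set B := Metric.ball z₀ ρ
  set D := Metric.closedBall y₀ (1 : ℝ)
  have hz₀ : z₀ ∈ B := Metric.mem_ball_self hρ
  have hBc : Convex ℝ B := convex_ball z₀ ρ
  have hC0 : 0 ≤ C := (norm_nonneg _).trans (hC y₀ (Metric.mem_closedBall_self zero_le_one))
  have hdist : ∀ z ∈ B, ‖z - z₀‖ ≤ ρ := fun z hz => by
    rw [← dist_eq_norm]; exact (Metric.mem_ball.1 hz).le
  -- One Picard iteration: on a disc `v ∘ u` has a holomorphic primitive, which takes the place of
  -- the integral.
  have step : ∀ u : {u : ℂ → E // DifferentiableOn ℂ u B ∧ Set.MapsTo u B D ∧ u z₀ = y₀},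
      ∃ w : {u : ℂ → E // DifferentiableOn ℂ u B ∧ Set.MapsTo u B D ∧ u z₀ = y₀},
        ∀ z ∈ B, HasDerivAt w.1 (v (u.1 z)) z := by
    rintro ⟨u, hu, huD, -⟩
    obtain ⟨w, hw₀, hw⟩ :=
      ((hv.comp_differentiableOn hu).isExactOn_ball).with_val_at z₀ y₀
    refine ⟨⟨w, fun z hz => (hw z hz).differentiableAt.differentiableWithinAt, ?_, hw₀⟩, hw⟩
    intro z hz
    have h := hBc.norm_image_sub_le_of_norm_hasDerivWithin_le (C := C)
      (fun x hx => (hw x hx).hasDerivWithinAt) (fun x hx => hC _ (huD hx)) hz₀ hz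
    rw [hw₀] at h
    rw [Metric.mem_closedBall, dist_eq_norm]
    exact h.trans ((mul_le_mul_of_nonneg_left (hdist z hz) hC0).trans hCρ)
  choose T hT using step
  let s : ℕ → {u : ℂ → E // DifferentiableOn ℂ u B ∧ Set.MapsTo u B D ∧ u z₀ = y₀} := fun k =>
    T^[k] ⟨fun _ => y₀, differentiableOn_const _,
      fun _ _ => Metric.mem_closedBall_self zero_le_one, rfl⟩
  have hs : ∀ k, ∀ z ∈ B, HasDerivAt (s (k + 1)).1 (v ((s k).1 z)) z := fun k z hz => by
    have := hT (s k) z hz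
    simpa only [s, Function.iterate_succ_apply'] using this
  have gap : ∀ k, ∀ z ∈ B, dist ((s k).1 z) ((s (k + 1)).1 z) ≤ 1 * (1 / 2 : ℝ) ^ k := by
    intro k
    induction k with
    | zero =>
      intro z hz
      have := (s 1).2.2.1 hz
      rw [Metric.mem_closedBall, dist_comm] at this
      simpa [s] using this
    | succ k ih =>
      intro z hz
      have h := hBc.norm_image_sub_le_of_norm_hasDerivWithin_le (C := K * (1 / 2 : ℝ) ^ k)
        (fun x hx => ((hs k x hx).sub (hs (k + 1) x hx)).hasDerivWithinAt)
        (fun x hx => by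
          rw [← dist_eq_norm]
          refine (hK.dist_le_mul _ ((s k).2.2.1 hx) _ ((s (k + 1)).2.2.1 hx)).trans ?_
          have := ih x hx
          rw [one_mul] at this
          gcongr) hz₀ hz
      have e : ((s (k + 1)).1 - (s (k + 1 + 1)).1) z₀ = 0 := by
        simp [(s (k + 1)).2.2.2, (s (k + 1 + 1)).2.2.2]
      rw [e, sub_zero] at h
      rw [dist_eq_norm, one_mul]
      calc _ ≤ K * (1 / 2 : ℝ) ^ k * ‖z - z₀‖ := h
        _ ≤ K * (1 / 2 : ℝ) ^ k * ρ := by have := hdist z hz; gcongr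
        _ = (K * ρ) * (1 / 2 : ℝ) ^ k := by ring
        _ ≤ 1 / 2 * (1 / 2 : ℝ) ^ k := by gcongr
        _ = _ := by ring
  have hlim : ∀ z, ∃ l, z ∈ B → Tendsto (fun k => (s k).1 z) atTop (𝓝 l) := fun z => by
    by_cases hz : z ∈ B
    · obtain ⟨l, hl⟩ := cauchySeq_tendsto_of_complete
        (cauchySeq_of_le_geometric (1 / 2) 1 (by norm_num) (fun k => gap k z hz))
      exact ⟨l, fun _ => hl⟩
    · exact ⟨0, fun h => absurd h hz⟩
  choose y hy using hlim
  have hyD : Set.MapsTo y B D := fun z hz =>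
    Metric.isClosed_closedBall.mem_of_tendsto (hy z hz)
      (Eventually.of_forall fun k => (s k).2.2.1 hz)
  refine ⟨y, tendsto_nhds_unique (hy z₀ hz₀) ?_, fun z hz => ?_⟩
  · simp only [(s _).2.2.2, tendsto_const_nhds]
  -- The derivatives `v ∘ s k` converge uniformly to `v ∘ y`, so the limit of the shifted sequence
  -- `s (k + 1)` solves the equation.
  refine hasDerivAt_of_tendstoLocallyUniformlyOn (l := atTop) Metric.isOpen_ball
    (g' := fun z => v (y z)) (f' := fun k z => v ((s k).1 z)) (f := fun k => (s (k + 1)).1) ?_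
    (Eventually.of_forall hs) (fun x hx => (hy x hx).comp (tendsto_add_atTop_nat 1)) hz
  refine TendstoUniformlyOn.tendstoLocallyUniformlyOn ?_
  rw [Metric.tendstoUniformlyOn_iff]
  intro ε hε
  have h0 : Tendsto (fun k : ℕ => (K : ℝ) * (1 * (1 / 2 : ℝ) ^ k / (1 - 1 / 2))) atTop (𝓝 0) := by
    have := (tendsto_pow_atTop_nhds_zero_of_lt_one (r := (1 / 2 : ℝ)) (by norm_num)
      (by norm_num)).const_mul ((K : ℝ) * (1 / (1 - 1 / 2)))
    rw [mul_zero] at this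
    refine this.congr fun k => by ring
  filter_upwards [h0.eventually (gt_mem_nhds hε)] with k hk x hx
  rw [dist_comm]
  refine ((hK.dist_le_mul _ ((s k).2.2.1 hx) _ (hyD hx)).trans ?_).trans_lt hk
  have := dist_le_of_le_geometric_of_tendsto (1 / 2) 1 (by norm_num) (fun k => gap k x hx)
    (hy x hx) k
  gcongr

/-- Local uniqueness for holomorphic ordinary differential equations. -/
theorem eventuallyEq_of_hasDerivAt_of_eq {E : Type*} [NormedAddCommGroup E] [NormedSpace ℂ E]
    {v : E → E} {y w : ℂ → E} {z₀ : ℂ} (hv : ContDiffAt ℂ 1 v (y z₀))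
    (hy : ∀ᶠ z in 𝓝 z₀, HasDerivAt y (v (y z)) z) (hw : ∀ᶠ z in 𝓝 z₀, HasDerivAt w (v (w z)) z)
    (h₀ : y z₀ = w z₀) : y =ᶠ[𝓝 z₀] w := by
  obtain ⟨K, t, ht, hK⟩ := hv.exists_lipschitzOnWith
  have hyc := hy.self_of_nhds.continuousAt
  have hwc := hw.self_of_nhds.continuousAt
  have hwt : w ⁻¹' t ∈ 𝓝 z₀ := hwc.preimage_mem_nhds (h₀ ▸ ht)
  have hyt : y ⁻¹' t ∈ 𝓝 z₀ := hyc.preimage_mem_nhds ht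
  have hbd : ∀ᶠ z in 𝓝 z₀, dist (y z) (w z) < 1 := by
    have : Tendsto (fun z => dist (y z) (w z)) (𝓝 z₀) (𝓝 0) := by
      have := hyc.tendsto.dist hwc.tendsto
      rwa [h₀, dist_self] at this
    exact this.eventually (gt_mem_nhds one_pos)
  obtain ⟨ρ, hρ, hball⟩ := Metric.eventually_nhds_iff_ball.1
    (hy.and (hw.and ((eventually_mem_set.2 hyt).and ((eventually_mem_set.2 hwt).and hbd))))
  set r := min ρ (1 / (2 * (K + 1)))
  have hr : 0 < r := lt_min hρ (by positivity)
  have hrK : K * r ≤ 1 / 2 := by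
    calc (K : ℝ) * r ≤ K * (1 / (2 * (K + 1))) := by gcongr; exact min_le_right _ _
      _ ≤ (K + 1) * (1 / (2 * (K + 1))) := by gcongr; linarith
      _ = 1 / 2 := by field_simp
  have hsub : ∀ z ∈ Metric.ball z₀ r, z ∈ Metric.ball z₀ ρ := fun z hz =>
    Metric.ball_subset_ball (min_le_left _ _) hz
  have key : ∀ k : ℕ, ∀ z ∈ Metric.ball z₀ r, ‖y z - w z‖ ≤ (1 / 2 : ℝ) ^ k := by
    intro k
    induction k with
    | zero => intro z hz; rw [← dist_eq_norm, pow_zero]; exact (hball z (hsub z hz)).2.2.2.2.le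
    | succ k ih =>
      intro z hz
      have h := (convex_ball z₀ r).norm_image_sub_le_of_norm_hasDerivWithin_le
        (C := K * (1 / 2 : ℝ) ^ k)
        (fun x hx => ((hball x (hsub x hx)).1.sub (hball x (hsub x hx)).2.1).hasDerivWithinAt)
        (fun x hx => by
          rw [← dist_eq_norm]
          refine (hK.dist_le_mul _ (hball x (hsub x hx)).2.2.1 _
            (hball x (hsub x hx)).2.2.2.1).trans ?_
          rw [dist_eq_norm]
          have := ih x hx
          gcongr) (Metric.mem_ball_self hr) hz
      simp only [Pi.sub_apply, h₀, sub_self, sub_zero] at h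
      have hd : ‖z - z₀‖ ≤ r := by rw [← dist_eq_norm]; exact (Metric.mem_ball.1 hz).le
      calc _ ≤ K * (1 / 2 : ℝ) ^ k * ‖z - z₀‖ := h
        _ ≤ K * (1 / 2 : ℝ) ^ k * r := by gcongr
        _ = (K * r) * (1 / 2 : ℝ) ^ k := by ring
        _ ≤ 1 / 2 * (1 / 2 : ℝ) ^ k := by gcongr
        _ = _ := by ring
  filter_upwards [Metric.ball_mem_nhds z₀ hr] with z hz
  have : ‖y z - w z‖ ≤ 0 := ge_of_tendsto' (tendsto_pow_atTop_nhds_zero_of_lt_one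
    (r := (1 / 2 : ℝ)) (by norm_num) (by norm_num)) (fun k => key k z hz)
  exact sub_eq_zero.1 (norm_le_zero_iff.1 this)

/-- Uniqueness for holomorphic ordinary differential equations on a preconnected open set. -/
theorem eqOn_of_hasDerivAt_of_eq {E : Type*} [NormedAddCommGroup E] [NormedSpace ℂ E]
    [CompleteSpace E] {v : E → E} (hv : ContDiff ℂ 1 v) {y w : ℂ → E} {z₀ : ℂ} {U : Set ℂ}
    (hU : IsOpen U) (hUc : IsPreconnected U) (hz₀ : z₀ ∈ U)
    (hy : ∀ z ∈ U, HasDerivAt y (v (y z)) z) (hw : ∀ z ∈ U, HasDerivAt w (v (w z)) z)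
    (h₀ : y z₀ = w z₀) : Set.EqOn y w U :=
  AnalyticOnNhd.eqOn_of_preconnected_of_eventuallyEq
    (DifferentiableOn.analyticOnNhd
      (fun z hz => (hy z hz).differentiableAt.differentiableWithinAt) hU)
    (DifferentiableOn.analyticOnNhd
      (fun z hz => (hw z hz).differentiableAt.differentiableWithinAt) hU) hUc hz₀
    (eventuallyEq_of_hasDerivAt_of_eq hv.contDiffAt (eventually_of_mem (hU.mem_nhds hz₀) hy)
      (eventually_of_mem (hU.mem_nhds hz₀) hw) h₀)

/-! ### The leaf system and uniqueness of its continuations -/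

/-- The first order system equivalent to `r'' = κ * r ^ (2 n - 1)`. -/
def leafField (κ : ℂ) (n : ℕ) (y : ℂ × ℂ) : ℂ × ℂ := (y.2, κ * y.1 ^ (2 * n - 1))

theorem contDiff_leafField (κ : ℂ) (n : ℕ) {m : WithTop ℕ∞} : ContDiff ℂ m (leafField κ n) := by
  unfold leafField
  fun_prop

theorem AnalyticAt.eventually_hasDerivAt_leafField {κ : ℂ} {n : ℕ} {f : ℂ → ℂ} {z₀ : ℂ}
    (hf : AnalyticAt ℂ f z₀) (ho : ∀ᶠ z in 𝓝 z₀, deriv (deriv f) z = κ * f z ^ (2 * n - 1)) :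
    ∀ᶠ z in 𝓝 z₀, HasDerivAt (fun z => (f z, deriv f z)) (leafField κ n (f z, deriv f z)) z := by
  filter_upwards [hf.eventually_analyticAt, ho] with z hz ho
  refine hz.differentiableAt.hasDerivAt.prodMk ?_
  rw [← ho]
  exact hz.deriv.differentiableAt.hasDerivAt

/-- The germs at `0` agree by ODE uniqueness, and the intersection of two sets star-shaped about `0`
is connected, so the identity theorem for meromorphic functions applies. -/
theorem IsLeafContinuation.eq {κ a b : ℂ} {n : ℕ} {U V : Set ℂ} {f g : ℂ → ℂ}
    (hf : IsLeafContinuation κ n a b U f) (hg : IsLeafContinuation κ n a b V g) {z : ℂ}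
    (hzU : z ∈ U) (hzV : z ∈ V) (hfz : AnalyticAt ℂ f z) (hgz : AnalyticAt ℂ g z) :
    f z = g z := by
  have h0 : f =ᶠ[𝓝 0] g := by
    have := eventuallyEq_of_hasDerivAt_of_eq (contDiff_leafField κ n).contDiffAt
      (hf.analyticAt_zero.eventually_hasDerivAt_leafField hf.ode)
      (hg.analyticAt_zero.eventually_hasDerivAt_leafField hg.ode)
      (by simp only [hf.value_zero, hg.value_zero, hf.deriv_zero, hg.deriv_zero])
    exact this.mono fun z hz => congrArg Prod.fst hz
  have hm : MeromorphicOn (f - g) (U ∩ V) := fun w hw =>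
    (hf.meromorphicOn w hw.1).sub (hg.meromorphicOn w hw.2)
  have hpc : IsPreconnected (U ∩ V) :=
    ((StarConvex.inter hf.starConvex hg.starConvex).isPathConnected
      ⟨hf.zero_mem, hg.zero_mem⟩).isConnected.isPreconnected
  -- A finite order at `z` would force a finite order at `0`, where `f - g` vanishes identically
  -- nearby.
  have htop : meromorphicOrderAt (f - g) z = ⊤ := by
    by_contra hne
    refine hm.meromorphicOrderAt_ne_top_of_isPreconnected hpc ⟨hzU, hzV⟩
      ⟨hf.zero_mem, hg.zero_mem⟩ hne ?_
    rw [meromorphicOrderAt_eq_top_iff]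
    refine Eventually.filter_mono nhdsWithin_le_nhds ?_
    filter_upwards [h0] with w hw
    simp [hw]
  rw [meromorphicOrderAt_eq_top_iff] at htop
  have h1 : Tendsto (f - g) (𝓝[≠] z) (𝓝 ((f - g) z)) :=
    (hfz.sub hgz).continuousAt.tendsto.mono_left nhdsWithin_le_nhds
  have h2 : Tendsto (f - g) (𝓝[≠] z) (𝓝 0) :=
    tendsto_const_nhds.congr' (htop.mono fun w hw => hw.symm)
  exact sub_eq_zero.1 (tendsto_nhds_unique h1 h2)

theorem leafValue_eq {κ a b : ℂ} {n : ℕ} {U : Set ℂ} {f : ℂ → ℂ}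
    (hf : IsLeafContinuation κ n a b U f) {z : ℂ} (hz : z ∈ U) (hfz : AnalyticAt ℂ f z) :
    leafValue κ n a b z = f z := by
  have h : z ∈ leafDomain κ n a b := ⟨(U, f), hf, hz, hfz⟩
  rw [leafValue, dif_pos h]
  exact h.choose_spec.1.eq hf h.choose_spec.2.1 hz h.choose_spec.2.2 hfz

/-! ### Scaling symmetries -/

theorem IsLeafContinuation.comp_mul {κ κ' a b c d : ℂ} {n : ℕ} {U : Set ℂ} {f : ℂ → ℂ}
    (hf : IsLeafContinuation κ n a b U f) (hκ : κ' * c ^ (2 * n - 1) = c * d ^ 2 * κ) :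
    IsLeafContinuation κ' n (c * a) (c * d * b) ((fun z => d * z) ⁻¹' U)
      (fun z => c * f (d * z)) := by
  have hcont : Continuous fun z : ℂ => d * z := by fun_prop
  have hd (w : ℂ) : AnalyticAt ℂ (fun z => d * z) w := by fun_prop
  have hder (g : ℂ → ℂ) (e : ℂ) :
      deriv (fun z => e * g (d * z)) = fun z => e * d * deriv g (d * z) := by
    ext z
    rw [deriv_const_mul_field, deriv_comp_mul_left, smul_eq_mul, mul_assoc]
  constructor
  · exact hf.isOpen.preimage hcont
  · simpa using hf.zero_mem
  · rw [starConvex_zero_iff]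
    intro x hx s hs hs1
    have := (starConvex_zero_iff.1 hf.starConvex) hx hs hs1
    simpa [mul_left_comm] using this
  · intro z hz
    exact (MeromorphicAt.const c z).mul ((hf.meromorphicOn _ hz).comp_analyticAt (hd z))
  · exact analyticAt_const.mul (AnalyticAt.fun_comp (by simpa using hf.analyticAt_zero) (hd 0))
  · have h0 : Tendsto (fun z : ℂ => d * z) (𝓝 0) (𝓝 0) := by
      simpa using hcont.tendsto 0
    filter_upwards [h0.eventually hf.ode] with z hz
    simp only [hder, hz, mul_pow]
    linear_combination (-f (d * z) ^ (2 * n - 1)) * hκ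
  · simp [hf.value_zero]
  · rw [hder]
    simp [hf.deriv_zero]

theorem mem_leafDomain_of_mul_mem {κ κ' a b c d : ℂ} {n : ℕ}
    (hκ : κ' * c ^ (2 * n - 1) = c * d ^ 2 * κ) {z : ℂ} (hz : d * z ∈ leafDomain κ n a b) :
    z ∈ leafDomain κ' n (c * a) (c * d * b) := by
  obtain ⟨⟨U, f⟩, hf, hU, hfz⟩ := hz
  exact ⟨(_, _), hf.comp_mul hκ, hU,
    analyticAt_const.mul (AnalyticAt.fun_comp hfz (by fun_prop))⟩

theorem leafValue_mul {κ κ' a b c d : ℂ} {n : ℕ}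
    (hκ : κ' * c ^ (2 * n - 1) = c * d ^ 2 * κ) {z : ℂ} (hz : d * z ∈ leafDomain κ n a b) :
    leafValue κ' n (c * a) (c * d * b) z = c * leafValue κ n a b (d * z) := by
  obtain ⟨⟨U, f⟩, hf, hU, hfz⟩ := hz
  rw [leafValue_eq hf hU hfz, leafValue_eq (hf.comp_mul hκ) hU
    (analyticAt_const.mul (AnalyticAt.fun_comp hfz (by fun_prop)))]

theorem mem_leafDomain_iff_mul_mem {κ κ' a b c d : ℂ} {n : ℕ} (hc : c ≠ 0) (hd : d ≠ 0)
    (hκ : κ' * c ^ (2 * n - 1) = c * d ^ 2 * κ) {z : ℂ} :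
    z ∈ leafDomain κ' n (c * a) (c * d * b) ↔ d * z ∈ leafDomain κ n a b := by
  refine ⟨fun hz => ?_, mem_leafDomain_of_mul_mem hκ⟩
  -- The converse is the same symmetry with the inverse factors.
  have := mem_leafDomain_of_mul_mem (c := c⁻¹) (d := d⁻¹) (κ' := κ) (κ := κ')
    (a := c * a) (b := c * d * b) (n := n) (z := d * z)
    (by rw [inv_pow]; field_simp; linear_combination -hκ) (by simpa [hd] using hz)
  convert this using 1
  all_goals field_simp

/-! ### Continuation along a real segment -/

theorem convex_Ioo_reProdIm_Ioo (a b c d : ℝ) :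
    Convex ℝ (Set.Ioo a b ×ℂ Set.Ioo c d) :=
  ((convex_Ioo a b).linear_preimage reLm).inter ((convex_Ioo c d).linear_preimage imLm)

/-- A solution of a holomorphic differential equation that stays bounded on the real segment
`[0, T]` extends to a rectangle around that segment. -/
theorem exists_holomorphic_solution_rect {E : Type*} [NormedAddCommGroup E] [NormedSpace ℂ E]
    [ProperSpace E] {v : E → E} (hv : ContDiff ℂ 1 v) {y₀ : E} {M T : ℝ} (hT : 0 ≤ T)
    (hM₀ : ‖y₀‖ ≤ M)
    (hM : ∀ δ > 0, ∀ t ≤ T, ∀ y : ℂ → E, y 0 = y₀ →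
      (∀ z ∈ Set.Ioo (-δ) t ×ℂ Set.Ioo (-δ) δ, HasDerivAt y (v (y z)) z) →
      ∀ x ∈ Set.Ico 0 t, ‖y (x : ℝ)‖ ≤ M) :
    ∃ δ > 0, ∃ t > T, ∃ y : ℂ → E, y 0 = y₀ ∧
      ∀ z ∈ Set.Ioo (-δ) t ×ℂ Set.Ioo (-δ) δ, HasDerivAt y (v (y z)) z := by
  -- The radius `M + 1` makes room for the unit ball around every value of norm at most `M`, so a
  -- single step size serves all restarts.
  have hcomp : IsCompact (Metric.closedBall (0 : E) (M + 1)) := isCompact_closedBall _ _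
  obtain ⟨K, hK⟩ := hv.locallyLipschitz.locallyLipschitzOn
    (s := Metric.closedBall (0 : E) (M + 1)) |>.exists_lipschitzOnWith_of_compact hcomp
  obtain ⟨C, hC⟩ := hcomp.exists_bound_of_continuousOn hv.continuous.continuousOn
  have hC0 : 0 ≤ C := (norm_nonneg _).trans (hC y₀ (by simpa using hM₀.trans (by linarith)))
  -- Picard needs `C * (4 * δ) ≤ 1` and `K * (4 * δ) ≤ 1 / 2`. A disc of radius `4 * δ` contains the
  -- box of half-width `2 * δ` and half-height `δ`.
  set δ : ℝ := 1 / (8 * (K + C + 1)) with hδdef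
  have hδ : 0 < δ := by positivity
  have hlocal : ∀ y₁ : E, ‖y₁‖ ≤ M → ∀ z₀ : ℂ, ∃ y : ℂ → E, y z₀ = y₁ ∧
      ∀ z ∈ Metric.ball z₀ (4 * δ), HasDerivAt y (v (y z)) z := fun y₁ hy₁ z₀ => by
    have hsub : Metric.closedBall y₁ 1 ⊆ Metric.closedBall (0 : E) (M + 1) :=
      Metric.closedBall_subset_closedBall' (by rw [dist_zero_right]; linarith)
    refine exists_holomorphic_solution_ball (hv.differentiable (by norm_num)) (hK.mono hsub)
      (fun y hy => hC y (hsub hy)) (by positivity) ?_ ?_ z₀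
    · have : C * (4 * δ) = C / (2 * (K + C + 1)) := by rw [hδdef]; field_simp; ring
      rw [this, div_le_one (by positivity)]
      linarith [K.coe_nonneg]
    · have : (K : ℝ) * (4 * δ) = K / (K + C + 1) / 2 := by rw [hδdef]; field_simp; ring
      rw [this]
      have : (K : ℝ) / (K + C + 1) ≤ 1 := by
        rw [div_le_one (by positivity)]; linarith
      linarith
  have hmem : ∀ (c : ℝ) (z : ℂ), c - 2 * δ < z.re → z.re < c + 2 * δ → -δ < z.im → z.im < δ →
      z ∈ Metric.ball (c : ℂ) (4 * δ) := fun c z h1 h2 h3 h4 => by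
    rw [Metric.mem_ball, dist_eq_norm]
    refine (norm_le_abs_re_add_abs_im _).trans_lt ?_
    simp only [sub_re, ofReal_re, sub_im, ofReal_im, sub_zero]
    have : |z.re - c| < 2 * δ := abs_lt.2 ⟨by linarith, by linarith⟩
    have : |z.im| < δ := abs_lt.2 ⟨h3, h4⟩
    linarith
  have main : ∀ k : ℕ, k * δ ≤ T → ∃ y : ℂ → E, y 0 = y₀ ∧
      ∀ z ∈ Set.Ioo (-δ) ((k + 1) * δ) ×ℂ Set.Ioo (-δ) δ, HasDerivAt y (v (y z)) z := by
    intro k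
    induction k with
    | zero =>
      intro _
      obtain ⟨y, hy₀, hy⟩ := hlocal y₀ hM₀ 0
      refine ⟨y, hy₀, fun z hz => hy z ?_⟩
      obtain ⟨⟨h1, h2⟩, h3, h4⟩ := hz
      simp only [Nat.cast_zero] at h2
      exact_mod_cast hmem 0 z (by linarith) (by linarith) h3 h4
    | succ k ih =>
      intro hk
      push_cast at hk ⊢
      obtain ⟨y, hy₀, hy⟩ := ih (by linarith)
      have hkδ : 0 ≤ k * δ := by positivity
      -- The restart is at `k * δ`, one step inside the open rectangle, and its box reaches `(k + 2)
      -- * δ`.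
      obtain ⟨w, hw₀, hw⟩ := hlocal (y ((k * δ : ℝ) : ℂ))
        (hM δ hδ _ hk y hy₀ hy _ ⟨hkδ, by linarith⟩) ((k * δ : ℝ) : ℂ)
      have heq : Set.EqOn y w (Set.Ioo (k * δ - δ) ((k + 1) * δ) ×ℂ Set.Ioo (-δ) δ) := by
        refine eqOn_of_hasDerivAt_of_eq hv (isOpen_Ioo.reProdIm isOpen_Ioo)
          (convex_Ioo_reProdIm_Ioo _ _ _ _).isPreconnected (z₀ := ((k * δ : ℝ) : ℂ))
          ?_ ?_ ?_ hw₀.symm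
        · refine ⟨⟨?_, ?_⟩, ?_, ?_⟩ <;> simp only [ofReal_re, ofReal_im] <;> linarith
        · rintro z ⟨⟨h1, h2⟩, h3⟩
          exact hy z ⟨⟨by linarith, h2⟩, h3⟩
        · rintro z ⟨⟨h1, h2⟩, h3, h4⟩
          exact hw z (hmem _ z (by linarith) (by linarith) h3 h4)
      refine ⟨fun z => if z.re < (k + 1) * δ then y z else w z, ?_, ?_⟩
      · have : (0 : ℝ) < (k + 1) * δ := by positivity
        simp only [zero_re, if_pos this, hy₀]
      rintro z ⟨⟨h1, h2⟩, h3, h4⟩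
      by_cases hz : z.re < (k + 1) * δ
      · have hev : (fun z => if z.re < (k + 1) * δ then y z else w z) =ᶠ[𝓝 z] y := by
          filter_upwards [(isOpen_lt continuous_re continuous_const).mem_nhds hz] with u hu
          exact if_pos hu
        rw [hev.hasDerivAt_iff]
        simp only [if_pos hz]
        exact hy z ⟨⟨h1, hz⟩, h3, h4⟩
      · have hev : (fun z => if z.re < (k + 1) * δ then y z else w z) =ᶠ[𝓝 z] w := by
          have hO : IsOpen (Set.Ioo (k * δ - δ) ((k + 1 + 1) * δ) ×ℂ Set.Ioo (-δ) δ) :=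
            isOpen_Ioo.reProdIm isOpen_Ioo
          filter_upwards [hO.mem_nhds ⟨⟨by linarith, h2⟩, h3, h4⟩] with u hu
          split_ifs with hlt
          · exact heq ⟨⟨hu.1.1, hlt⟩, hu.2⟩
          · rfl
        rw [hev.hasDerivAt_iff]
        simp only [if_neg hz]
        exact hw z (hmem _ z (by linarith) (by linarith) h3 h4)
  obtain ⟨y, hy₀, hy⟩ := main ⌊T / δ⌋₊ (by
    rw [← le_div_iff₀ hδ]; exact Nat.floor_le (by positivity))
  refine ⟨δ, hδ, _, ?_, y, hy₀, hy⟩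
  rw [gt_iff_lt, ← div_lt_iff₀ hδ]
  exact Nat.lt_floor_add_one _

/-- A real solution on an open interval of the system equivalent to `r'' = κ * r ^ (2 n - 1)`. -/
structure IsRealLeafSolution (κ : ℝ) (n : ℕ) (s t : ℝ) (p q : ℝ → ℝ) : Prop where
  hasDerivAt_fst : ∀ x ∈ Set.Ioo s t, HasDerivAt p (q x) x
  hasDerivAt_snd : ∀ x ∈ Set.Ioo s t, HasDerivAt q (κ * p x ^ (2 * n - 1)) x

theorem exists_isRealLeafSolution {κ a b δ t : ℝ} {n : ℕ} (hδ : 0 < δ) (ht : 0 < t)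
    {y : ℂ → ℂ × ℂ} (hy₀ : y 0 = ((a : ℂ), (b : ℂ)))
    (hy : ∀ z ∈ Set.Ioo (-δ) t ×ℂ Set.Ioo (-δ) δ, HasDerivAt y (leafField κ n (y z)) z) :
    ∃ p q : ℝ → ℝ, IsRealLeafSolution κ n (-δ) t p q ∧ p 0 = a ∧ q 0 = b ∧
      ∀ x ∈ Set.Ioo (-δ) t, y (x : ℝ) = ((p x : ℂ), (q x : ℂ)) := by
  set R := Set.Ioo (-δ) t ×ℂ Set.Ioo (-δ) δ
  let conj := starRingEnd ℂ
  have hR : ∀ z ∈ R, conj z ∈ R := by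
    rintro z ⟨h1, h3, h4⟩
    refine ⟨by simpa [conj] using h1, ?_⟩
    rw [Set.mem_preimage, conj_im]
    exact ⟨by linarith, by linarith⟩
  have hfst : ∀ z ∈ R, HasDerivAt (fun z => (y z).1) (y z).2 z := fun z hz => (hy z hz).fst
  have hsnd : ∀ z ∈ R, HasDerivAt (fun z => (y z).2) (κ * (y z).1 ^ (2 * n - 1)) z :=
    fun z hz => (hy z hz).snd
  have hreal : ∀ x : ℝ, x ∈ Set.Ioo (-δ) t → (x : ℂ) ∈ R := fun x hx =>
    ⟨by simpa using hx, by simpa using hδ⟩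
  -- Reflection: `κ`, `a` and `b` are real, so the conjugated solution solves the same problem, and
  -- uniqueness makes `y` real on the real axis.
  have heq : Set.EqOn y (fun z => (conj (y (conj z)).1, conj (y (conj z)).2)) R := by
    refine eqOn_of_hasDerivAt_of_eq (contDiff_leafField κ n) (isOpen_Ioo.reProdIm isOpen_Ioo)
      (convex_Ioo_reProdIm_Ioo _ _ _ _).isPreconnected (z₀ := 0) ?_ hy ?_ ?_
    · exact_mod_cast hreal 0 ⟨by linarith, ht⟩
    · intro z hz
      have h1 := (hfst _ (hR z hz)).conj_conj
      have h2 := (hsnd _ (hR z hz)).conj_conj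
      have h := h1.prodMk h2
      simp only [conj, leafField, Function.comp_def, map_mul, map_pow, conj_ofReal,
        Complex.conj_conj] at h ⊢
      exact h
    · simp [conj, hy₀]
  have hyre : ∀ x ∈ Set.Ioo (-δ) t,
      y (x : ℝ) = ((((y (x : ℝ)).1.re : ℝ) : ℂ), (((y (x : ℝ)).2.re : ℝ) : ℂ)) := fun x hx => by
    have h := heq (hreal x hx)
    simp only [conj, conj_ofReal] at h
    exact Prod.ext (conj_eq_iff_re.1 (congrArg Prod.fst h).symm).symm
      (conj_eq_iff_re.1 (congrArg Prod.snd h).symm).symm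
  refine ⟨fun x => (y (x : ℝ)).1.re, fun x => (y (x : ℝ)).2.re, ⟨fun x hx => ?_, fun x hx => ?_⟩,
    by simp [hy₀], by simp [hy₀], hyre⟩
  · exact (hfst _ (hreal x hx)).real_of_complex
  · have h := (hsnd _ (hreal x hx)).real_of_complex
    have e : ((κ : ℂ) * (y (x : ℝ)).1 ^ (2 * n - 1)).re
        = κ * (y (x : ℝ)).1.re ^ (2 * n - 1) := by
      have h1 := congrArg Prod.fst (hyre x hx)
      simp only at h1
      rw [h1, ← ofReal_pow, ← ofReal_mul, ofReal_re, ofReal_re]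
    rw [e] at h
    exact h

/-- A real point `T ≥ 0` belongs to the domain as soon as the real solutions obey an a priori
bound on `[0, T]`. -/
theorem mem_leafDomain_of_bound {κ a b M T : ℝ} {n : ℕ} (hT : 0 ≤ T) (ha : |a| ≤ M) (hb : |b| ≤ M)
    (hM : ∀ δ > 0, ∀ t > 0, t ≤ T → ∀ p q : ℝ → ℝ, IsRealLeafSolution κ n (-δ) t p q →
      p 0 = a → q 0 = b → ∀ x ∈ Set.Ico 0 t, |p x| ≤ M ∧ |q x| ≤ M) :
    (T : ℂ) ∈ leafDomain κ n a b := by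
  have hnorm : ∀ p q : ℝ, |p| ≤ M → |q| ≤ M → ‖((p : ℂ), (q : ℂ))‖ ≤ M := fun p q hp hq => by
    rw [Prod.norm_mk, norm_real, norm_real]
    exact max_le hp hq
  obtain ⟨δ, hδ, t, ht, y, hy₀, hy⟩ := exists_holomorphic_solution_rect
    (contDiff_leafField κ n) (y₀ := ((a : ℂ), (b : ℂ))) hT (hnorm a b ha hb)
    (fun δ hδ t ht y hy₀ hy x hx => by
      have ht0 := hx.1.trans_lt hx.2
      obtain ⟨p, q, hpq, hp, hq, he⟩ := exists_isRealLeafSolution hδ ht0 hy₀ hy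
      rw [he x ⟨by linarith [hx.1], hx.2⟩]
      have := hM δ hδ t ht0 ht p q hpq hp hq x hx
      exact hnorm _ _ this.1 this.2)
  set R := Set.Ioo (-δ) t ×ℂ Set.Ioo (-δ) δ
  have hRo : IsOpen R := isOpen_Ioo.reProdIm isOpen_Ioo
  have hreal : ∀ x : ℝ, x ∈ Set.Ioo (-δ) t → (x : ℂ) ∈ R := fun x hx =>
    ⟨by simpa using hx, by simpa using hδ⟩
  have h0 : (0 : ℂ) ∈ R := by exact_mod_cast hreal 0 ⟨by linarith, by linarith⟩
  have hfst : ∀ z ∈ R, HasDerivAt (fun z => (y z).1) (y z).2 z := fun z hz => (hy z hz).fst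
  have hsnd : ∀ z ∈ R, HasDerivAt (fun z => (y z).2) (κ * (y z).1 ^ (2 * n - 1)) z :=
    fun z hz => (hy z hz).snd
  have han : AnalyticOnNhd ℂ (fun z => (y z).1) R := DifferentiableOn.analyticOnNhd
    (fun z hz => (hfst z hz).differentiableAt.differentiableWithinAt) hRo
  have hd : ∀ z ∈ R, deriv (fun z => (y z).1) z = (y z).2 := fun z hz => (hfst z hz).deriv
  have hTR : (T : ℂ) ∈ R := hreal T ⟨by linarith, ht⟩
  refine ⟨(R, fun z => (y z).1), ?_, hTR, han _ hTR⟩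
  constructor
  · exact hRo
  · exact h0
  · exact (convex_Ioo_reProdIm_Ioo _ _ _ _).starConvex h0
  · exact fun z hz => (han z hz).meromorphicAt
  · exact han 0 h0
  · filter_upwards [hRo.mem_nhds h0] with z hz
    have hev : deriv (fun z => (y z).1) =ᶠ[𝓝 z] fun z => (y z).2 :=
      eventually_of_mem (hRo.mem_nhds hz) hd
    rw [hev.deriv_eq]
    exact (hsnd z hz).deriv
  · simp [hy₀]
  · rw [hd 0 h0, hy₀]

/-! ### Energy, travel time and a priori bounds -/

namespace IsRealLeafSolution

variable {κ s t : ℝ} {n : ℕ} {p q : ℝ → ℝ}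

theorem continuousOn_fst (h : IsRealLeafSolution κ n s t p q) : ContinuousOn p (Set.Ioo s t) :=
  fun x hx => (h.hasDerivAt_fst x hx).continuousAt.continuousWithinAt

theorem continuousOn_snd (h : IsRealLeafSolution κ n s t p q) : ContinuousOn q (Set.Ioo s t) :=
  fun x hx => (h.hasDerivAt_snd x hx).continuousAt.continuousWithinAt

/-- Conservation of energy. -/
theorem energy_eq (h : IsRealLeafSolution κ n s t p q) {x y : ℝ}
    (hx : x ∈ Set.Ioo s t) (hy : y ∈ Set.Ioo s t) :
    n * q x ^ 2 - κ * p x ^ (2 * n) = n * q y ^ 2 - κ * p y ^ (2 * n) := by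
  have hd : ∀ x ∈ Set.Ioo s t, HasDerivAt (fun x => n * q x ^ 2 - κ * p x ^ (2 * n)) 0 x := by
    intro x hx
    have := (((h.hasDerivAt_snd x hx).pow 2).const_mul (n : ℝ)).sub
      (((h.hasDerivAt_fst x hx).pow (2 * n)).const_mul κ)
    refine this.congr_deriv ?_
    push_cast
    ring
  exact isOpen_Ioo.is_const_of_deriv_eq_zero isPreconnected_Ioo
    (fun x hx => (hd x hx).differentiableAt.differentiableWithinAt) (fun x hx => (hd x hx).deriv)
    hx hy

end IsRealLeafSolution

theorem ContinuousOn.pos_of_ne_zero {f : ℝ → ℝ} {a b : ℝ} (hab : a ≤ b)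
    (hf : ContinuousOn f (Set.Icc a b)) (ha : 0 < f a) (h : ∀ x ∈ Set.Icc a b, f x ≠ 0) :
    0 < f b := by
  by_contra! hb
  obtain ⟨u, hu, hu0⟩ := intermediate_value_Icc' hab hf ⟨hb, ha.le⟩
  exact h u hu hu0

/-- The cutoff `X` becomes the a priori bound for `p`. -/
theorem exists_lt_setLIntegral_Ioo {g : ℝ → ENNReal} {a : ℝ} {T : ENNReal}
    (h : T < ∫⁻ u in Set.Ioi a, g u) : ∃ X : ℝ, T < ∫⁻ u in Set.Ioo a X, g u := by
  have hU : Set.Ioi a = ⋃ k : ℕ, Set.Ioo a k := by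
    ext u
    simp only [Set.mem_Ioi, Set.mem_iUnion, Set.mem_Ioo, exists_and_left]
    exact ⟨fun hu => ⟨hu, exists_nat_gt u⟩, fun hu => hu.1⟩
  rw [hU, setLIntegral_iUnion_of_directed _ (Monotone.directed_le fun i j hij =>
    Set.Ioo_subset_Ioo_right (Nat.cast_le.2 hij)), lt_iSup_iff] at h
  obtain ⟨k, hk⟩ := h
  exact ⟨k, hk⟩

/-- Separation of variables: the time in which a solution of `p' = q`, `q ^ 2 = w p` with `q > 0`
travels from `p 0` to `p x` is at least `∫ du / √(w u)`. -/
theorem setLIntegral_one_div_sqrt_le {p q w : ℝ → ℝ} {x : ℝ} (hx : 0 ≤ x)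
    (hp : ∀ u ∈ Set.Icc 0 x, HasDerivAt p (q u) u) (hq : ∀ u ∈ Set.Ioo 0 x, 0 < q u)
    (hw : ∀ u ∈ Set.Ioo 0 x, q u ^ 2 = w (p u)) :
    ∫⁻ u in Set.Ioo (p 0) (p x), ENNReal.ofReal (1 / √(w u)) ≤ ENNReal.ofReal x := by
  have hcont : ContinuousOn p (Set.Icc 0 x) := fun u hu =>
    (hp u hu).continuousAt.continuousWithinAt
  -- The open interval is used because for `cleafh` the velocity vanishes at time `0`.
  have hmono : MonotoneOn p (Set.Ioo 0 x) := by
    refine monotoneOn_of_deriv_nonneg (convex_Ioo 0 x) (hcont.mono Set.Ioo_subset_Icc_self) ?_ ?_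
    all_goals rw [interior_Ioo]; intro u hu
    · exact (hp u (Set.Ioo_subset_Icc_self hu)).differentiableAt.differentiableWithinAt
    · rw [(hp u (Set.Ioo_subset_Icc_self hu)).deriv]
      exact (hq u hu).le
  calc ∫⁻ u in Set.Ioo (p 0) (p x), ENNReal.ofReal (1 / √(w u))
      ≤ ∫⁻ u in p '' Set.Ioo 0 x, ENNReal.ofReal (1 / √(w u)) :=
        lintegral_mono_set (intermediate_value_Ioo hx hcont)
    _ = ∫⁻ u in Set.Ioo 0 x, ENNReal.ofReal (q u) * ENNReal.ofReal (1 / √(w (p u))) :=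
        lintegral_image_eq_lintegral_deriv_mul_of_monotoneOn measurableSet_Ioo
          (fun u hu => (hp u (Set.Ioo_subset_Icc_self hu)).hasDerivWithinAt) hmono _
    _ = ∫⁻ u in Set.Ioo 0 x, 1 := by
        refine setLIntegral_congr_fun measurableSet_Ioo fun u hu => ?_
        have := hq u hu
        rw [← hw u hu, Real.sqrt_sq this.le, ← ENNReal.ofReal_mul this.le,
          mul_one_div_cancel this.ne', ENNReal.ofReal_one]
    _ = ENNReal.ofReal x := by simp

namespace IsRealLeafSolution

variable {t δ : ℝ} {n : ℕ} {p q : ℝ → ℝ}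

theorem sq_add_pow_eq (hn : 1 ≤ n) (h : IsRealLeafSolution (-n) n (-δ) t p q) (hδ : 0 < δ)
    {x : ℝ} (hx : x ∈ Set.Ico 0 t) : q x ^ 2 + p x ^ (2 * n) = q 0 ^ 2 + p 0 ^ (2 * n) := by
  have hn0 : (n : ℝ) ≠ 0 := by positivity
  have := h.energy_eq (x := x) (y := 0) ⟨by linarith [hx.1], hx.2⟩
    ⟨by linarith, hx.1.trans_lt hx.2⟩
  refine mul_left_cancel₀ hn0 ?_
  linear_combination this

theorem sq_eq_pow_add (hn : 1 ≤ n) (h : IsRealLeafSolution n n (-δ) t p q) (hδ : 0 < δ)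
    {x : ℝ} (hx : x ∈ Set.Ico 0 t) : q x ^ 2 = p x ^ (2 * n) + (q 0 ^ 2 - p 0 ^ (2 * n)) := by
  have hn0 : (n : ℝ) ≠ 0 := by positivity
  have := h.energy_eq (x := x) (y := 0) ⟨by linarith [hx.1], hx.2⟩
    ⟨by linarith, hx.1.trans_lt hx.2⟩
  refine mul_left_cancel₀ hn0 ?_
  linear_combination this

theorem abs_le_one (hn : 1 ≤ n) (h : IsRealLeafSolution (-n) n (-δ) t p q) (hδ : 0 < δ)
    (h₀ : q 0 ^ 2 + p 0 ^ (2 * n) = 1) {x : ℝ} (hx : x ∈ Set.Ico 0 t) :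
    |p x| ≤ 1 ∧ |q x| ≤ 1 := by
  have he := (h.sq_add_pow_eq hn hδ hx).trans h₀
  have h1 : 0 ≤ p x ^ (2 * n) := (even_two_mul n).pow_nonneg _
  constructor
  · have : |p x| ^ (2 * n) ≤ 1 := by
      rw [(even_two_mul n).pow_abs]; nlinarith [sq_nonneg (q x)]
    exact (pow_le_one_iff_of_nonneg (abs_nonneg _) (by omega)).1 this
  · exact (sq_le_one_iff_abs_le_one _).1 (by linarith)

/-- If `p` passed `X` by time `x`, its travel time would be at least the integral up to `X`, which
exceeds `T`. The energy then bounds `q`. -/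
theorem abs_le_of_lt_setLIntegral (hn : 1 ≤ n) (h : IsRealLeafSolution n n (-δ) t p q)
    (hδ : 0 < δ) {X T : ℝ} {w : ℝ → ℝ} (hp₀ : 0 ≤ p 0) (hc : q 0 ^ 2 - p 0 ^ (2 * n) ≤ 1)
    (hw : ∀ u, w u = u ^ (2 * n) + (q 0 ^ 2 - p 0 ^ (2 * n)))
    (hq : ∀ x ∈ Set.Ioo 0 t, 0 < q x) (hT : t ≤ T)
    (hX : ENNReal.ofReal T < ∫⁻ u in Set.Ioo (p 0) X, ENNReal.ofReal (1 / √(w u)))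
    {x : ℝ} (hx : x ∈ Set.Ico 0 t) :
    |p x| ≤ |X| + |X| ^ (2 * n) + 1 ∧ |q x| ≤ |X| + |X| ^ (2 * n) + 1 := by
  have hd : ∀ u ∈ Set.Icc 0 x, HasDerivAt p (q u) u := fun u hu =>
    h.hasDerivAt_fst u ⟨by linarith [hu.1], hu.2.trans_lt hx.2⟩
  have hpX : p x ≤ X := by
    by_contra! hlt
    refine absurd (hX.trans_le ((lintegral_mono_set (Set.Ioo_subset_Ioo_right hlt.le)).trans
      (setLIntegral_one_div_sqrt_le hx.1 hd (fun u hu => hq u ⟨hu.1, hu.2.trans hx.2⟩)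
        fun u hu => ?_))) (not_lt.2 (ENNReal.ofReal_le_ofReal (hx.2.le.trans hT)))
    rw [hw, h.sq_eq_pow_add hn hδ ⟨hu.1.le, hu.2.trans hx.2⟩]
  have hmono : p 0 ≤ p x := by
    refine monotoneOn_of_deriv_nonneg (convex_Icc 0 x)
      (fun u hu => (hd u hu).continuousAt.continuousWithinAt) ?_ ?_ (Set.left_mem_Icc.2 hx.1)
      (Set.right_mem_Icc.2 hx.1) hx.1
    all_goals rw [interior_Icc]; intro u hu
    · exact (hd u (Set.Ioo_subset_Icc_self hu)).differentiableAt.differentiableWithinAt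
    · rw [(hd u (Set.Ioo_subset_Icc_self hu)).deriv]
      exact (hq u ⟨hu.1, hu.2.trans hx.2⟩).le
  have hpabs : |p x| ≤ |X| := by
    rw [abs_of_nonneg (hp₀.trans hmono)]
    exact hpX.trans (le_abs_self X)
  have hXpow : 0 ≤ |X| ^ (2 * n) := by positivity
  refine ⟨by linarith, ?_⟩
  have hsq : q x ^ 2 ≤ |X| ^ (2 * n) + 1 := by
    rw [h.sq_eq_pow_add hn hδ hx, ← (even_two_mul n).pow_abs]
    have := pow_le_pow_left₀ (abs_nonneg _) hpabs (2 * n)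
    linarith
  have : |q x| ≤ |X| ^ (2 * n) + 1 := by
    refine abs_le_of_sq_le_sq (hsq.trans ?_) (by linarith)
    nlinarith
  linarith [abs_nonneg X]

/-- Here `q ^ 2 = p ^ (2 * n) + 1` never vanishes, so `q` keeps its initial sign. -/
theorem snd_pos_of_fst_zero (hn : 1 ≤ n) (h : IsRealLeafSolution n n (-δ) t p q) (hδ : 0 < δ)
    (hp₀ : p 0 = 0) (hq₀ : q 0 = 1) {x : ℝ} (hx : x ∈ Set.Ioo 0 t) : 0 < q x := by
  refine (h.continuousOn_snd.mono fun u hu => ⟨by linarith [hu.1], hu.2.trans_lt hx.2⟩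
    ).pos_of_ne_zero hx.1.le (by rw [hq₀]; exact one_pos) fun u hu h0 => ?_
  have he := h.sq_eq_pow_add hn hδ ⟨hu.1, hu.2.trans_lt hx.2⟩
  rw [h0, hp₀, hq₀, zero_pow (by omega : 2 * n ≠ 0)] at he
  have : 0 ≤ p u ^ (2 * n) := (even_two_mul n).pow_nonneg _
  linarith

/-- Since `q 0 = 0`, the sign argument is applied to `p`: `p ^ (2 * n) = q ^ 2 + 1` keeps `p`
positive, hence `q' > 0`. -/
theorem snd_pos_of_snd_zero (hn : 1 ≤ n) (h : IsRealLeafSolution n n (-δ) t p q) (hδ : 0 < δ)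
    (hp₀ : p 0 = 1) (hq₀ : q 0 = 0) {x : ℝ} (hx : x ∈ Set.Ioo 0 t) : 0 < q x := by
  have hsub : Set.Icc 0 x ⊆ Set.Ioo (-δ) t := fun u hu => ⟨by linarith [hu.1], hu.2.trans_lt hx.2⟩
  have hp : ∀ y ∈ Set.Icc 0 x, 0 < p y := fun y hy => by
    refine (h.continuousOn_fst.mono ((Set.Icc_subset_Icc_right hy.2).trans hsub)).pos_of_ne_zero
      hy.1 (by rw [hp₀]; exact one_pos) fun u hu h0 => ?_
    have he := h.sq_eq_pow_add hn hδ ⟨hu.1, (hu.2.trans hy.2).trans_lt hx.2⟩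
    rw [h0, hp₀, hq₀, zero_pow (by omega : 2 * n ≠ 0), one_pow] at he
    linarith [sq_nonneg (q u)]
  have hmono : StrictMonoOn q (Set.Icc 0 x) := by
    refine strictMonoOn_of_deriv_pos (convex_Icc 0 x) (h.continuousOn_snd.mono hsub) ?_
    rw [interior_Icc]
    intro u hu
    have hu' := Set.Ioo_subset_Icc_self hu
    rw [(h.hasDerivAt_snd u (hsub hu')).deriv]
    have := hp u hu'
    have hn0 : (0 : ℝ) < n := by positivity
    positivity
  have := hmono (Set.left_mem_Icc.2 hx.1.le) (Set.right_mem_Icc.2 hx.1.le) hx.1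
  rwa [hq₀] at this

end IsRealLeafSolution

/-! ### Real points of the four domains -/

/-- Parity reduces to `l ≥ 0`: the scaling with `d = -1` preserves the problem, with `c = -1` for
the odd functions and `c = 1` for the even ones. -/
theorem ofReal_mem_leafDomain_of_abs {κ c a b : ℂ} {n : ℕ} (hn : 1 ≤ n) (hc : c ^ 2 = 1)
    (ha : c * a = a) (hb : c * b = -b) {l : ℝ} (h : ((|l| : ℝ) : ℂ) ∈ leafDomain κ n a b) :
    (l : ℂ) ∈ leafDomain κ n a b := by
  rcases abs_choice l with hl | hl <;> rw [hl] at h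
  · exact h
  · have := mem_leafDomain_of_mul_mem (c := c) (d := -1) (κ' := κ) (κ := κ) (z := (l : ℂ))
      (a := a) (b := b) (n := n) (by
        obtain ⟨m, rfl⟩ : ∃ m, n = m + 1 := ⟨n - 1, by omega⟩
        rw [show 2 * (m + 1) - 1 = 2 * m + 1 by omega, pow_succ, pow_mul, hc]
        ring) (by simpa using h)
    rwa [ha, mul_neg_one, neg_mul, hb, neg_neg] at this

theorem ofReal_mem_sleafDomain {n : ℕ} (hn : 1 ≤ n) (l : ℝ) : (l : ℂ) ∈ sleafDomain n := by
  refine ofReal_mem_leafDomain_of_abs hn (c := -1) (by norm_num) (by simp) (by simp) ?_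
  have := mem_leafDomain_of_bound (κ := -n) (a := 0) (b := 1) (M := 1) (n := n) (abs_nonneg l)
    (by simp) (by simp) fun δ hδ t _ _ p q h hp hq x hx => h.abs_le_one hn hδ
      (by rw [hp, hq, zero_pow (by omega : 2 * n ≠ 0)]; norm_num) hx
  exact_mod_cast this

theorem ofReal_mem_cleafDomain {n : ℕ} (hn : 1 ≤ n) (l : ℝ) : (l : ℂ) ∈ cleafDomain n := by
  refine ofReal_mem_leafDomain_of_abs hn (c := 1) (by norm_num) (by simp) (by simp) ?_
  have := mem_leafDomain_of_bound (κ := -n) (a := 1) (b := 0) (M := 1) (n := n) (abs_nonneg l)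
    (by simp) (by simp) fun δ hδ t _ _ p q h hp hq x hx => h.abs_le_one hn hδ
      (by rw [hp, hq]; norm_num) hx
  exact_mod_cast this

theorem ofReal_mem_sleafhDomain {n : ℕ} (hn : 1 ≤ n) {l : ℝ}
    (hl : ENNReal.ofReal |l| < leafZeta n) : (l : ℂ) ∈ sleafhDomain n := by
  refine ofReal_mem_leafDomain_of_abs hn (c := -1) (by norm_num) (by simp) (by simp) ?_
  obtain ⟨X, hX⟩ := exists_lt_setLIntegral_Ioo hl
  have hM : (1 : ℝ) ≤ |X| + |X| ^ (2 * n) + 1 := by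
    have : 0 ≤ |X| + |X| ^ (2 * n) := by positivity
    linarith
  have h2n : 2 * n ≠ 0 := by omega
  have := mem_leafDomain_of_bound (κ := n) (a := 0) (b := 1) (M := |X| + |X| ^ (2 * n) + 1)
    (n := n) (abs_nonneg l) (by simpa using zero_le_one.trans hM) (by simpa using hM)
    fun δ hδ t _ htl p q h hp hq x hx => h.abs_le_of_lt_setLIntegral hn hδ hp.ge
      (by simp [hp, hq, h2n]) (w := fun u => 1 + u ^ (2 * n))
      (fun u => by simp [hp, hq, h2n, add_comm])
      (fun x hx => h.snd_pos_of_fst_zero hn hδ hp hq hx) htl (by rwa [hp]) hx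
  exact_mod_cast this

theorem ofReal_mem_cleafhDomain {n : ℕ} (hn : 1 ≤ n) {l : ℝ}
    (hl : ENNReal.ofReal |l| < leafEta n) : (l : ℂ) ∈ cleafhDomain n := by
  refine ofReal_mem_leafDomain_of_abs hn (c := 1) (by norm_num) (by simp) (by simp) ?_
  obtain ⟨X, hX⟩ := exists_lt_setLIntegral_Ioo hl
  have hM : (1 : ℝ) ≤ |X| + |X| ^ (2 * n) + 1 := by
    have : 0 ≤ |X| + |X| ^ (2 * n) := by positivity
    linarith
  have := mem_leafDomain_of_bound (κ := n) (a := 1) (b := 0) (M := |X| + |X| ^ (2 * n) + 1)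
    (n := n) (abs_nonneg l) (by simpa using hM) (by simpa using zero_le_one.trans hM)
    fun δ hδ t _ htl p q h hp hq x hx => h.abs_le_of_lt_setLIntegral hn hδ
      (by rw [hp]; exact zero_le_one) (by simp [hp, hq]) (w := fun u => u ^ (2 * n) - 1)
      (fun u => by simp [hp, hq, sub_eq_add_neg])
      (fun x hx => h.snd_pos_of_snd_zero hn hδ hp hq hx) htl (by rwa [hp]) hx
  exact_mod_cast this

/-! ### Rotation by `I` and the main theorem -/

theorem neg_I_pow_two_mul_sub_one {n : ℕ} (hn : 1 ≤ n) :
    (-I) ^ (2 * n - 1) = -I * (-1) ^ (n - 1) := by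
  obtain ⟨m, rfl⟩ : ∃ m, n = m + 1 := ⟨n - 1, by omega⟩
  rw [show 2 * (m + 1) - 1 = 2 * m + 1 by omega, pow_succ, pow_mul, neg_sq, I_sq,
    Nat.add_sub_cancel, mul_comm]

/-- The leaf functions with `r 0 = 0`, `r' 0 = 1` under rotation of the argument by `I`. -/
theorem leafDomain_leafValue_mul_I {κ κ' : ℂ} {n : ℕ} (hn : 1 ≤ n)
    (hκ : κ' * (-1) ^ (n - 1) = -κ) (l : ℂ) :
    (l ∈ leafDomain κ' n 0 1 ↔ I * l ∈ leafDomain κ n 0 1) ∧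
    (l ∈ leafDomain κ' n 0 1 →
      leafValue κ' n 0 1 l = -I * leafValue κ n 0 1 (I * l)) := by
  -- The factor `-I` is forced by `c * d = 1`, which keeps `r' 0 = 1`.
  have h : κ' * (-I) ^ (2 * n - 1) = -I * I ^ 2 * κ := by
    rw [neg_I_pow_two_mul_sub_one hn, I_sq]
    linear_combination (-I) * hκ
  have hiff := mem_leafDomain_iff_mul_mem (a := 0) (b := 1) (z := l) (neg_ne_zero.2 I_ne_zero)
    I_ne_zero h
  have hval := leafValue_mul (a := 0) (b := 1) (z := l) h
  have e : -I * I * 1 = 1 := by simp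
  rw [mul_zero, e] at hiff hval
  exact ⟨hiff, fun hl => hval (hiff.1 hl)⟩

/-- The leaf functions with `r 0 = 1`, `r' 0 = 0` under rotation of the argument by `I`. -/
theorem leafDomain_leafValue_neg_mul_I (κ : ℂ) (n : ℕ) (l : ℂ) :
    (l ∈ leafDomain (-κ) n 1 0 ↔ I * l ∈ leafDomain κ n 1 0) ∧
    (l ∈ leafDomain (-κ) n 1 0 → leafValue (-κ) n 1 0 l = leafValue κ n 1 0 (I * l)) := by
  have h : -κ * 1 ^ (2 * n - 1) = 1 * I ^ 2 * κ := by simp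
  have hiff := mem_leafDomain_iff_mul_mem (a := 1) (b := 0) (z := l) one_ne_zero I_ne_zero h
  have hval := leafValue_mul (a := 1) (b := 0) (z := l) h
  rw [one_mul, mul_zero] at hiff hval
  rw [one_mul] at hval
  exact ⟨hiff, fun hl => hval (hiff.1 hl)⟩

theorem mainTheorem9 (n : ℕ) (hn : 1 ≤ n) :
    -- all four functions are defined on the real domains on which they are considered
    (∀ l : ℝ, (l : ℂ) ∈ sleafDomain n ∧ (l : ℂ) ∈ cleafDomain n) ∧
    (∀ l : ℝ, ENNReal.ofReal |l| < leafZeta n → (l : ℂ) ∈ sleafhDomain n) ∧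
    (∀ l : ℝ, ENNReal.ofReal |l| < leafEta n → (l : ℂ) ∈ cleafhDomain n) ∧
    -- odd `n`
    (Odd n →
      (∀ l : ℂ, l ∈ sleafDomain n ↔ I * l ∈ sleafhDomain n) ∧
      (∀ l ∈ sleafDomain n, sleaf n l = -I * sleafh n (I * l))) ∧
    -- even `n`, in particular `n = 2`
    (Even n →
      (∀ l : ℂ, l ∈ sleafDomain n ↔ I * l ∈ sleafDomain n) ∧
      (∀ l ∈ sleafDomain n, sleaf n (I * l) = I * sleaf n l) ∧
      (∀ l : ℂ, l ∈ sleafhDomain n ↔ I * l ∈ sleafhDomain n) ∧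
      (∀ l ∈ sleafhDomain n, sleafh n (I * l) = I * sleafh n l)) ∧
    -- all `n`
    (∀ l : ℂ, l ∈ cleafDomain n ↔ I * l ∈ cleafhDomain n) ∧
    (∀ l ∈ cleafDomain n, cleaf n l = cleafh n (I * l)) ∧
    (∀ l : ℂ, l ∈ cleafhDomain n ↔ I * l ∈ cleafDomain n) ∧
    (∀ l ∈ cleafhDomain n, cleaf n (I * l) = cleafh n l) := by
  have hpow : ∀ {m : ℕ}, Odd m → (-1 : ℂ) ^ (m - 1) = 1 := fun hm =>
    (Nat.Odd.sub_odd hm odd_one).neg_one_pow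
  refine ⟨fun l => ⟨ofReal_mem_sleafDomain hn l, ofReal_mem_cleafDomain hn l⟩,
    fun l hl => ofReal_mem_sleafhDomain hn hl, fun l hl => ofReal_mem_cleafhDomain hn hl,
    fun hodd => ?_, fun heven => ?_, ?_, ?_, ?_, ?_⟩
  · have h := leafDomain_leafValue_mul_I (κ := n) (κ' := -n) hn (by rw [hpow hodd, mul_one])
    exact ⟨fun l => (h l).1, fun l hl => (h l).2 hl⟩
  · have hs : (-1 : ℂ) ^ (n - 1) = -1 :=
      (Nat.Even.sub_odd hn heven odd_one).neg_one_pow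
    have h := leafDomain_leafValue_mul_I (κ := -n) (κ' := -n) hn (by rw [hs, mul_neg_one])
    have h' := leafDomain_leafValue_mul_I (κ := n) (κ' := n) hn (by rw [hs, mul_neg_one])
    refine ⟨fun l => (h l).1, fun l hl => ?_, fun l => (h' l).1, fun l hl => ?_⟩
    · rw [sleaf, sleaf, (h l).2 hl, neg_mul, mul_neg, ← mul_assoc, I_mul_I, neg_one_mul, neg_neg]
    · rw [sleafh, sleafh, (h' l).2 hl, neg_mul, mul_neg, ← mul_assoc, I_mul_I, neg_one_mul,
        neg_neg]
  · exact fun l => (leafDomain_leafValue_neg_mul_I n n l).1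
  · exact fun l hl => (leafDomain_leafValue_neg_mul_I n n l).2 hl
  · intro l
    have h := (leafDomain_leafValue_neg_mul_I (-n) n l).1
    rwa [neg_neg] at h
  · intro l hl
    have h := (leafDomain_leafValue_neg_mul_I (-n) n l).2
    rw [neg_neg] at h
    exact (h hl).symm
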